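/- A \emph{$4$-colored generalized Frobenius partition} of an integer $m\ge 0$ is a two-rowed array $\begin{pmatrix} a_1 & a_2 & \cdots & a_r\\ b_1 & b_2 & \cdots & b_r\end{pmatrix}$ with $r\ge 0$, whose entries are nonnegative integers each carrying one of $4$ colors $1,2,3,4$, such that each row is strictly decreasing with respect to the lexicographic order (first compare the integers, then, for equal integers, the colors), and such that $m = r+\sum_{i=1}^r a_i+\sum_{i=1}^r b_i$, where only the integer values of the entries are added. Let $c\phi_4(m)$ denote the number of such arrays. Then for all integers $n\ge 0$, $$c\phi_4(10n+6)\equiv 0 \pmod 5.$$ -/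

import Mathlib

/-- A nonnegative integer in one of `k` colors. Colored integers are ordered lexicographically:
first by their size, then by their color. -/
abbrev ColoredNat (k : ℕ) : Type := ℕ ×ₗ Fin k

/-- The nonnegative integer underlying a colored integer. -/
def ColoredNat.size {k : ℕ} (x : ColoredNat k) : ℕ := (ofLex x).1

/-- A `k`-colored generalized Frobenius partition of `n`: a two-rowed array
`(a₁ a₂ ⋯ aᵣ ; b₁ b₂ ⋯ bᵣ)` of nonnegative integers in `k` colors, with both rows of the same
length `r ≥ 0` and strictly decreasing in the order of the colored integers, such that
`n = r + (a₁ + ⋯ + aᵣ) + (b₁ + ⋯ + bᵣ)`. -/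
@[ext]
structure ColoredFrobeniusPartition (k n : ℕ) where
  /-- The upper row. -/
  top : List (ColoredNat k)
  /-- The lower row. -/
  bot : List (ColoredNat k)
  length_eq : top.length = bot.length
  top_decreasing : top.Pairwise (· > ·)
  bot_decreasing : bot.Pairwise (· > ·)
  weight_eq : top.length + (top.map ColoredNat.size).sum + (bot.map ColoredNat.size).sum = n

/-- There are only finitely many such arrays for given `k` and `n`, so that `Nat.card` below
really counts them. -/
instance ColoredFrobeniusPartition.instFinite (k n : ℕ) :
    Finite (ColoredFrobeniusPartition k n) := by
  let s : Set (ColoredNat k) := {x | x.size ≤ n}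
  have hs : s.Finite := by
    refine ((Set.finite_Iic n).prod (Set.finite_univ (α := Fin k))).subset
      (s := (Set.Iic n) ×ˢ Set.univ) (t := s) ?_
    intro x hx
    exact ⟨hx, trivial⟩
  have : Finite s := hs
  let L : Set (List (ColoredNat k)) := List.map Subtype.val '' {l : List s | l.length ≤ n}
  have hL : L.Finite := (List.finite_length_le s n).image _
  have key : ∀ l : List (ColoredNat k), l.length ≤ n →
      (l.map ColoredNat.size).sum ≤ n → l ∈ L := by
    intro l h1 h2
    have h3 : ∀ x ∈ l, x ∈ s := fun x hx =>
      (List.single_le_sum (fun _ _ => Nat.zero_le _) _ (List.mem_map_of_mem hx)).trans h2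
    lift l to List s using h3
    exact ⟨l, by simpa using h1, rfl⟩
  have : Finite L := hL
  refine Finite.of_injective (β := L × L) (fun P =>
    (⟨P.top, key _ (by have := P.weight_eq; omega) (by have := P.weight_eq; omega)⟩,
     ⟨P.bot, key _ (by have := P.weight_eq; have := P.length_eq; omega)
      (by have := P.weight_eq; omega)⟩)) ?_
  intro P Q h
  simp only [Prod.mk.injEq, Subtype.mk.injEq] at h
  exact ColoredFrobeniusPartition.ext h.1 h.2

/-- `cφ k n` is the number of `k`-colored generalized Frobenius partitions of `n`. -/
noncomputable def cφ (k n : ℕ) : ℕ := Nat.card (ColoredFrobeniusPartition k n)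

/-!
Write `E(q) = ∏ (1 - q ^ n)` (in Lean: `pentagonalSeries`), `φ(q) = ∑ q ^ (m ^ 2)` and
`Ψ(q) = ∑ q ^ (m * (m + 1) / 2)`, both sums over all integers `m`.

Sorting the entries of a `k`-colored Frobenius partition by color turns it into `k` pairs of finite
sets of natural numbers, that is, `k` Maya diagrams of total charge zero. A Maya diagram is the
translate by its charge `m` of a diagram of charge zero, which raises its energy by
`m * (m - 1) / 2`; and the diagrams of charge zero have generating series `1 / E`. Hence
`∑ cφ k n * q ^ n` is the theta series of the root lattice of type `A` of rank `k - 1` divided by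
`E ^ k` (`cφ_mul_pentagonalSeries_pow`). The same splitting of Maya diagrams proves the Jacobi
triple product (`thetaSeries_eq`): its constant term is found by specializing to the pentagonal
number theorem. Other specializations give Gauss's product formulas for `φ(-q)` and `Ψ(q)`, and, at
an infinitesimal deformation of `-1` in the dual numbers, Jacobi's series for `E ^ 3`.

For `k = 4`, changes of lattice basis express the theta series by `φ` and `Ψ`, and bisecting
the quotient by `E ^ 4` gives, for `B(q) = ∑ cφ 4 (2 * n) * q ^ n`,
`B(q) * E(q) ^ 10 = E(q²) ^ 4 * φ(q) ^ 5 + 48 * q * φ(q) * E(q⁴) ^ 8` (`sectionSeries_cφ_mul`).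
Modulo `5`, fifth powers are series in `q ^ 5`, so for the exponents `5 * n + 3` only the factors
`E(q²) ^ 4` and `q * φ(q) * E(q⁴) ^ 3` matter. By Jacobi's series their terms are indexed by
pairs of integers with coefficient divisible by an odd number `2 * j + 1`; an exponent of the form
`5 * n + 3` makes a binary quadratic form without nontrivial zeros modulo `5` vanish at a point
with coordinate `2 * j + 1`, and therefore `5` divides `2 * j + 1`.
-/

section ColoredFrobenius

open PowerSeries Finset
open scoped PowerSeries.WithPiTopology

/-! ### Generating series of weighted index types -/

section Weighted

variable {ι κ R : Type*} [CommRing R]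

/-- A weight function on an index type is *proper* if only finitely many indices have any given
weight, so that the generating series `∑ i, c i * X ^ w i` makes sense for all coefficients `c`. -/
def ProperWeight (w : ι → ℕ) : Prop := ∀ n, {i | w i = n}.Finite

lemma ProperWeight.of_le {v w : ι → ℕ} (hv : ProperWeight v) (h : ∀ i, v i ≤ w i) :
    ProperWeight w := fun n =>
  ((Set.finite_Iic n).biUnion fun m _ => hv m).subset fun i hi => by
    simp only [Set.mem_iUnion]
    exact ⟨v i, (h i).trans_eq hi, rfl⟩

lemma ProperWeight.comp_injective {w : ι → ℕ} (hw : ProperWeight w) {f : κ → ι}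
    (hf : Function.Injective f) : ProperWeight fun k => w (f k) := fun n =>
  (hw n).preimage hf.injOn

lemma ProperWeight.prod {v : ι → ℕ} {w : κ → ℕ} (hv : ProperWeight v) (hw : ProperWeight w) :
    ProperWeight fun p : ι × κ => v p.1 + w p.2 := fun n => by
  refine (((Set.finite_Iic n).biUnion fun m _ => hv m).prod
      ((Set.finite_Iic n).biUnion fun m _ => hw m)).subset ?_
  rintro ⟨i, k⟩ h
  simp only [Set.mem_ofPred_eq] at h
  simp only [Set.mem_prod, Set.mem_iUnion]
  exact ⟨⟨v i, by simp; omega, rfl⟩, ⟨w k, by simp; omega, rfl⟩⟩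

lemma ProperWeight.pi {w : ι → ℕ} (hw : ProperWeight w) (k : ℕ) :
    ProperWeight fun x : Fin k → ι => ∑ i, w (x i) := fun n => by
  refine (Set.Finite.pi' (t := fun _ : Fin k => ⋃ m ∈ Set.Iic n, {i | w i = m})
    fun _ => (Set.finite_Iic n).biUnion fun m _ => hw m).subset ?_
  intro x hx i
  simp only [Set.mem_iUnion]
  exact ⟨w (x i), (single_le_sum (f := fun i => w (x i)) (fun _ _ => Nat.zero_le _)
    (mem_univ i)).trans_eq hx, rfl⟩

variable [TopologicalSpace R]

lemma ProperWeight.summable {w : ι → ℕ} (hw : ProperWeight w) (c : ι → R) :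
    Summable fun i => monomial (w i) (c i) := by
  rw [WithPiTopology.summable_iff_summable_coeff]
  intro d
  refine summable_of_hasFiniteSupport ((hw d).subset fun i hi => ?_)
  by_contra h
  exact hi (by simp only [coeff_monomial]; exact if_neg (Ne.symm h))

/-- The product of two generating series is the generating series of the product index type. -/
lemma HasSum.mul_monomial [DiscreteTopology R] {v : ι → ℕ} {w : κ → ℕ}
    (hv : ProperWeight v) (hw : ProperWeight w)
    {b : ι → R} {c : κ → R} {F G : R⟦X⟧} (hF : HasSum (fun i => monomial (v i) (b i)) F)
    (hG : HasSum (fun k => monomial (w k) (c k)) G) :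
    HasSum (fun p : ι × κ => monomial (v p.1 + w p.2) (b p.1 * c p.2)) (F * G) := by
  have e : (fun p : ι × κ => monomial (v p.1 + w p.2) (b p.1 * c p.2)) =
      fun p : ι × κ => monomial (v p.1) (b p.1) * monomial (w p.2) (c p.2) :=
    funext fun p => (PowerSeries.monomial_mul_monomial _ _ _ _).symm
  have h := (hv.prod hw).summable fun p => b p.1 * c p.2
  rw [e] at h ⊢
  exact HasSum.mul (f := fun i => monomial (v i) (b i)) (g := fun k => monomial (w k) (c k)) hF hG h

/-- The `k`-th power of a generating series is the generating series of `k`-tuples of indices. -/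
lemma HasSum.pow_monomial [DiscreteTopology R] {w : ι → ℕ} (hw : ProperWeight w) {F : R⟦X⟧}
    (hF : HasSum (fun i => monomial (w i) 1) F) (k : ℕ) :
    HasSum (fun x : Fin k → ι => monomial (∑ i, w (x i)) 1) (F ^ k) := by
  induction k with
  | zero => simp
  | succ k ih =>
    have h := hF.mul_monomial hw (hw.pi k) ih
    rw [← pow_succ'] at h
    rw [← (Fin.consEquiv fun _ => ι).hasSum_iff]
    convert h using 2 with x
    simp [Fin.consEquiv, Fin.sum_univ_succ]

/-- The counting series of a proper weight function. -/
lemma ProperWeight.hasSum_card {w : ι → ℕ} (hw : ProperWeight w) :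
    HasSum (fun i => monomial (w i) (1 : R)) (mk fun n => (Nat.card {i // w i = n} : R)) := by
  classical
  rw [WithPiTopology.hasSum_iff_hasSum_coeff]
  intro d
  simp only [coeff_mk, coeff_monomial]
  have h : (Nat.card {i // w i = d} : R) = ∑ i ∈ (hw d).toFinset, if d = w i then 1 else 0 := by
    rw [sum_congr rfl (g := fun _ => (1 : R))
      (fun i hi => if_pos (by simpa using hi : w i = d).symm)]
    rw [sum_const, nsmul_one, ← Nat.card_eq_card_finite_toFinset (hw d)]
    rfl
  rw [h]
  exact hasSum_sum_of_ne_finset_zero fun i hi => if_neg fun h' => hi (by simp [h'])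

lemma continuous_expand (p : ℕ) (hp : p ≠ 0) : Continuous (expand (R := R) p hp) := by
  refine continuous_iff_continuousAt.2 fun F => ?_
  rw [ContinuousAt, WithPiTopology.tendsto_iff_coeff_tendsto]
  intro d
  simp only [coeff_expand]
  split_ifs
  · exact (WithPiTopology.continuous_coeff R _).continuousAt
  · exact tendsto_const_nhds

/-- Substituting `X ^ p` for `X` in a generating series. -/
lemma HasSum.expand_monomial {w : ι → ℕ} {c : ι → R} {F : R⟦X⟧}
    (hF : HasSum (fun i => monomial (w i) (c i)) F) (p : ℕ) (hp : p ≠ 0) :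
    HasSum (fun i => monomial (p * w i) (c i)) (expand p hp F) := by
  simpa [Function.comp_def] using hF.map (expand p hp) (continuous_expand p hp)

/-- Multiplying a generating series by a monomial. -/
lemma HasSum.monomial_mul_monomial [DiscreteTopology R] {w : ι → ℕ} {c : ι → R} {F : R⟦X⟧}
    (hF : HasSum (fun i => monomial (w i) (c i)) F) (n : ℕ) (a : R) :
    HasSum (fun i => monomial (n + w i) (a * c i)) (monomial n a * F) := by
  simp_rw [← PowerSeries.monomial_mul_monomial]
  exact hF.mul_left _

lemma HasSum.coeff_eq_zero [T2Space R] {w : ι → ℕ} {c : ι → R} {F : R⟦X⟧}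
    (hF : HasSum (fun i => monomial (w i) (c i)) F) {n : ℕ} (h : ∀ i, w i = n → c i = 0) :
    coeff n F = 0 := by
  rw [WithPiTopology.hasSum_iff_hasSum_coeff] at hF
  refine (hF n).unique ?_
  convert hasSum_zero with i
  rw [coeff_monomial]
  split_ifs with hi
  · exact h i hi.symm
  · rfl

end Weighted

/-! ### Sections of power series along arithmetic progressions -/

section Sections

variable {R : Type*} [CommRing R]

/-- The `p`-section of a power series: the series of its coefficients at the exponents
`p * n + r`. -/
noncomputable def sectionSeries (p r : ℕ) (F : R⟦X⟧) : R⟦X⟧ := mk fun n => coeff (p * n + r) F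

lemma sectionSeries_add (p r : ℕ) (F G : R⟦X⟧) :
    sectionSeries p r (F + G) = sectionSeries p r F + sectionSeries p r G := by
  ext n; simp [sectionSeries]

lemma coeff_X_mul_expand (p : ℕ) (hp : 1 < p) (F : R⟦X⟧) (n : ℕ) :
    coeff (p * n) (X * expand p (by omega) F) = 0 := by
  rcases n with _ | n
  · simp
  · rw [show p * (n + 1) = (p * n + (p - 1)) + 1 by rw [mul_add]; omega, coeff_succ_X_mul]
    refine coeff_expand_of_not_dvd _ _ _ fun h => ?_
    have := Nat.le_of_dvd (by omega) ((Nat.dvd_add_right (dvd_mul_right p n)).1 h)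
    omega

/-- Taking sections is linear over series in `X ^ p`. -/
lemma sectionSeries_mul_expand {p r : ℕ} (hp : p ≠ 0) (hr : r < p) (F G : R⟦X⟧) :
    sectionSeries p r (F * expand p hp G) = sectionSeries p r F * G := by
  ext n
  simp only [sectionSeries, coeff_mk, coeff_mul]
  symm
  refine sum_of_injOn (fun q => (p * q.1 + r, p * q.2)) ?_ ?_ ?_ ?_
  · rintro ⟨a, b⟩ _ ⟨c, d⟩ _ h
    simp only [Prod.mk.injEq, add_left_inj, mul_eq_mul_left_iff, hp, or_false] at h
    exact Prod.ext h.1 h.2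
  · rintro ⟨a, b⟩ h
    have h : a + b = n := by simpa using h
    simp only [mem_coe, HasAntidiagonal.mem_antidiagonal]
    rw [← h]; ring
  · rintro ⟨a, b⟩ h h'
    rw [HasAntidiagonal.mem_antidiagonal] at h
    simp only at h
    by_cases hb : p ∣ b
    · exfalso
      obtain ⟨b, rfl⟩ := hb
      have hbn : b ≤ n := by
        by_contra! hlt
        have := Nat.mul_le_mul_left p (show n + 1 ≤ b from hlt)
        rw [mul_add] at this
        omega
      obtain ⟨c, rfl⟩ := Nat.exists_eq_add_of_le hbn
      refine h' ⟨(c, b), by simp [add_comm], ?_⟩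
      simp only [Prod.mk.injEq, and_true]
      rw [mul_add] at h
      omega
    · simp only [coeff_expand_of_not_dvd p hp _ hb, mul_zero]
  · rintro ⟨a, b⟩ _
    simp only [coeff_expand_mul]

end Sections

/-! ### Maya diagrams -/

section Maya

/-- A finite set of natural numbers is the same as the answer to whether it contains `0`, together
with the finite set of predecessors of its positive elements. -/
noncomputable def finsetNatEquiv : Finset ℕ ≃ Bool × Finset ℕ where
  toFun S := (decide (0 ∈ S), S.preimage Nat.succ Nat.succ_injective.injOn)
  invFun p := if p.1 then insert 0 (p.2.image Nat.succ) else p.2.image Nat.succ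
  left_inv S := by
    ext n
    by_cases h : 0 ∈ S <;> cases n <;> simp [h]
  right_inv p := by
    obtain ⟨b, S⟩ := p
    refine Prod.ext ?_ ?_
    · cases b <;> simp
    · ext n
      cases b <;> simp

lemma sum_finsetNatEquiv_symm {M : Type*} [AddCommMonoid M] (b : Bool) (S : Finset ℕ) (g : ℕ → M) :
    ∑ i ∈ finsetNatEquiv.symm (b, S), g i = (if b then g 0 else 0) + ∑ i ∈ S, g (i + 1) := by
  cases b <;> simp [finsetNatEquiv]

/-- A pair `(S, T)` of finite sets of natural numbers, encoding the Maya diagram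
`S ∪ {-(t + 1) | t ∉ T} ⊆ ℤ`: the elements of `S` are the occupied nonnegative positions and those
of `T` label the holes among the negative ones. -/
abbrev Maya : Type := Finset ℕ × Finset ℕ

namespace Maya

/-- The charge of a Maya diagram: the number of particles minus the number of holes. -/
def charge (x : Maya) : ℤ := (x.1.card : ℤ) - x.2.card

/-- The energy of a Maya diagram: a particle at `s` contributes `s`, and a hole at `-(t + 1)`
contributes `t + 1`. -/
def weight (x : Maya) : ℕ := ∑ s ∈ x.1, s + ∑ t ∈ x.2, (t + 1)

/-- Translation of a Maya diagram by one step to the right. -/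
noncomputable def shift : Equiv.Perm Maya where
  toFun x := (finsetNatEquiv.symm (!(finsetNatEquiv x.2).1, x.1), (finsetNatEquiv x.2).2)
  invFun x := ((finsetNatEquiv x.1).2, finsetNatEquiv.symm (!(finsetNatEquiv x.1).1, x.2))
  left_inv x := by simp
  right_inv x := by simp

lemma charge_shift (x : Maya) : charge (shift x) = charge x + 1 := by
  obtain ⟨S, T⟩ := x
  obtain ⟨⟨b, T⟩, rfl⟩ := finsetNatEquiv.symm.surjective T
  simp only [charge, shift, Equiv.coe_fn_mk, Equiv.apply_symm_apply, card_eq_sum_ones,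
    sum_finsetNatEquiv_symm]
  cases b <;> simp <;> ring

lemma weight_shift (x : Maya) : (weight (shift x) : ℤ) = weight x + charge x := by
  obtain ⟨S, T⟩ := x
  obtain ⟨⟨b, T⟩, rfl⟩ := finsetNatEquiv.symm.surjective T
  simp only [weight, charge, shift, Equiv.coe_fn_mk, Equiv.apply_symm_apply, card_eq_sum_ones,
    sum_finsetNatEquiv_symm]
  cases b <;> simp [sum_add_distrib] <;> ring

lemma charge_shift_zpow (m : ℤ) (x : Maya) : charge ((shift ^ m) x) = charge x + m := by
  induction m using Int.induction_on with
  | zero => simp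
  | succ i ih => rw [add_comm, zpow_add, zpow_one, Equiv.Perm.mul_apply, charge_shift, ih]; ring
  | pred i ih =>
    have h : (shift ^ (-(i : ℤ))) x = shift ((shift ^ (-(i : ℤ) - 1)) x) := by
      rw [← Equiv.Perm.mul_apply, ← zpow_one_add, add_sub_cancel]
    rw [h, charge_shift] at ih
    linarith

lemma weight_shift_zpow (m : ℤ) (x : Maya) :
    2 * (weight ((shift ^ m) x) : ℤ) = 2 * weight x + 2 * m * charge x + m * (m - 1) := by
  induction m using Int.induction_on with
  | zero => simp
  | succ i ih =>
    rw [add_comm, zpow_add, zpow_one, Equiv.Perm.mul_apply, weight_shift, charge_shift_zpow]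
    linear_combination ih
  | pred i ih =>
    have h : (shift ^ (-(i : ℤ))) x = shift ((shift ^ (-(i : ℤ) - 1)) x) := by
      rw [← Equiv.Perm.mul_apply, ← zpow_one_add, add_sub_cancel]
    rw [h, weight_shift, charge_shift_zpow] at ih
    linear_combination ih

/-- The Maya diagrams of charge zero, which encode the ordinary partitions. -/
abbrev Neutral : Type := {x : Maya // charge x = 0}

/-- Every Maya diagram is the translate by its charge of a unique neutral one. -/
noncomputable def equivNeutral : ℤ × Neutral ≃ Maya where
  toFun p := (shift ^ p.1) p.2.1
  invFun x := (charge x, ⟨(shift ^ (-charge x)) x, by rw [charge_shift_zpow]; ring⟩)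
  left_inv p := by
    obtain ⟨m, x, hx⟩ := p
    have h : charge ((shift ^ m) x) = m := by rw [charge_shift_zpow, hx, zero_add]
    refine Prod.ext h (Subtype.ext ?_)
    simp only [h, ← Equiv.Perm.mul_apply, ← zpow_add]
    simp
  right_inv x := by
    dsimp only
    rw [← Equiv.Perm.mul_apply, ← zpow_add]; simp

@[simp]
lemma charge_equivNeutral (p : ℤ × Neutral) : charge (equivNeutral p) = p.1 := by
  rw [equivNeutral, Equiv.coe_fn_mk, charge_shift_zpow, p.2.2, zero_add]

lemma weight_equivNeutral (p : ℤ × Neutral) :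
    (weight (equivNeutral p) : ℤ) = weight p.2.1 + p.1 * (p.1 - 1) / 2 := by
  have h := weight_shift_zpow p.1 p.2.1
  rw [p.2.2] at h
  rw [equivNeutral, Equiv.coe_fn_mk]
  omega

end Maya

lemma properWeight_sum {f : ℕ → ℕ} (hf : ∀ n, n ≤ f n) :
    ProperWeight fun S : Finset ℕ => ∑ i ∈ S, f i := fun n => by
  refine (Set.finite_Iic (range (n + 1))).subset fun S hS => ?_
  simp only [Set.mem_ofPred_eq] at hS
  intro i hi
  have := single_le_sum (f := f) (fun _ _ => Nat.zero_le _) hi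
  have := hf i
  simp; omega

lemma Maya.properWeight : ProperWeight Maya.weight :=
  (properWeight_sum fun n => le_refl n).prod (properWeight_sum fun n => Nat.le_succ n)

end Maya

/-! ### Theta series and the triple product up to its constant term -/

section Theta

/-- The exponent `a * m * (m - 1) / 2 + r * m` of a theta series. It is nonnegative if `r ≤ a`. -/
def thetaExp (a r : ℕ) (m : ℤ) : ℕ := (a * (m * (m - 1) / 2) + r * m).toNat

lemma two_mul_choose_two (m : ℤ) : 2 * (m * (m - 1) / 2) = m * (m - 1) :=
  Int.mul_ediv_cancel' (by have := Int.even_mul_pred_self m; exact this.two_dvd)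

lemma thetaExp_bound {a r : ℕ} (ha : 0 < a) (hr : r ≤ a) (m : ℤ) :
    |m| - 1 ≤ a * (m * (m - 1) / 2) + r * m ∧ 0 ≤ a * (m * (m - 1) / 2) + r * m := by
  have h := two_mul_choose_two m
  set c := m * (m - 1) / 2
  have ha' : (1 : ℤ) ≤ a := by exact_mod_cast ha
  have hr' : (r : ℤ) ≤ a := by exact_mod_cast hr
  have hr0 : (0 : ℤ) ≤ r := by positivity
  rcases le_or_gt 0 m with hm | hm
  · rw [abs_of_nonneg hm]
    have h1 : m - 1 ≤ c := by nlinarith [sq_nonneg (m - 1), mul_self_nonneg (m - 2)]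
    have h0 : 0 ≤ c := by
      rcases hm.eq_or_lt with rfl | hm
      · omega
      · nlinarith
    constructor <;> nlinarith [mul_nonneg hr0 hm]
  · rw [abs_of_neg hm]
    have h1 : -m - 1 ≤ c + m := by nlinarith [mul_self_nonneg (m + 1), mul_self_nonneg (m + 2)]
    have h0 : 0 ≤ c + m := by omega
    have h2 : r * m ≥ a * m := by nlinarith
    have h3 : a * (c + m) ≥ c + m := by nlinarith
    constructor <;> nlinarith

lemma thetaExp_cast {a r : ℕ} (ha : 0 < a) (hr : r ≤ a) (m : ℤ) :
    (thetaExp a r m : ℤ) = a * (m * (m - 1) / 2) + r * m :=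
  Int.toNat_of_nonneg (thetaExp_bound ha hr m).2

lemma thetaExp_proper {a r : ℕ} (ha : 0 < a) (hr : r ≤ a) : ProperWeight (thetaExp a r) :=
  fun n => by
  refine (Set.finite_Icc (-(n + 1) : ℤ) (n + 1)).subset fun m hm => ?_
  have h1 := (thetaExp_bound ha hr m).1
  rw [← thetaExp_cast ha hr, show thetaExp a r m = n from hm] at h1
  rw [Set.mem_Icc, ← abs_le]
  linarith

variable {R : Type*} [CommRing R] [TopologicalSpace R]

/-- The theta series `∑ m : ℤ, u ^ m * X ^ (a * m * (m - 1) / 2 + r * m)`, meaningful for `0 < a`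
and `r ≤ a`. In particular `thetaSeries 1 2 1` is `φ(q)` and `thetaSeries 1 1 1` is `Ψ(q)`. -/
noncomputable def thetaSeries (u : Rˣ) (a r : ℕ) : R⟦X⟧ :=
  ∑' m : ℤ, monomial (thetaExp a r m) ((u ^ m : Rˣ) : R)

lemma hasSum_thetaSeries (u : Rˣ) {a r : ℕ} (ha : 0 < a) (hr : r ≤ a) :
    HasSum (fun m : ℤ => monomial (thetaExp a r m) ((u ^ m : Rˣ) : R)) (thetaSeries u a r) :=
  ((thetaExp_proper ha hr).summable _).hasSum

variable (R) in
/-- The generating series of the neutral Maya diagrams by weight. -/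
noncomputable def neutralSeries : R⟦X⟧ := ∑' x : Maya.Neutral, monomial (Maya.weight x.1) 1

lemma Maya.properWeight_neutral : ProperWeight fun x : Maya.Neutral => Maya.weight x.1 :=
  Maya.properWeight.comp_injective Subtype.val_injective

variable (R) in
lemma hasSum_neutralSeries :
    HasSum (fun x : Maya.Neutral => monomial (Maya.weight x.1) (1 : R)) (neutralSeries R) :=
  (Maya.properWeight_neutral.summable _).hasSum

/-- Expansion of an infinite product as a sum over finite sets. -/
lemma exists_hasProd_hasSum {f : ℕ → ℕ} (hf : ∀ n, n ≤ f n) (u : R) :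
    ∃ G : R⟦X⟧, HasProd (fun n => 1 + monomial (f n) u) G ∧
      HasSum (fun S : Finset ℕ => monomial (∑ i ∈ S, f i) (u ^ S.card)) G := by
  obtain ⟨G, hG⟩ := (properWeight_sum hf).summable fun S => u ^ S.card
  refine ⟨G, hasProd_one_add_of_hasSum_prod ?_, hG⟩
  simpa only [PowerSeries.prod_monomial, prod_const] using hG

lemma hasSum_of_hasProd [T2Space R] {f : ℕ → ℕ} (hf : ∀ n, n ≤ f n) {u : R} {G : R⟦X⟧}
    (h : HasProd (fun n => 1 + monomial (f n) u) G) :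
    HasSum (fun S : Finset ℕ => monomial (∑ i ∈ S, f i) (u ^ S.card)) G := by
  obtain ⟨G', h1, h2⟩ := exists_hasProd_hasSum hf u
  rwa [h.unique h1]

variable [DiscreteTopology R]

/-- The Jacobi triple product identity, up to the identification of the constant term: expanding
both products gives a sum over Maya diagrams, which splits over charge and neutral part. -/
lemma thetaSeries_mul_neutralSeries (u : Rˣ) {a r s : ℕ} (ha : 0 < a) (hrs : r + s = a)
    {F G : R⟦X⟧} (hF : HasProd (fun n => 1 + monomial (a * n + r) (u : R)) F)
    (hG : HasProd (fun n => 1 + monomial (a * n + s) ((u⁻¹ : Rˣ) : R)) G) :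
    thetaSeries u a r * expand a ha.ne' (neutralSeries R) = F * G := by
  have hle : ∀ r n, n ≤ a * n + r := fun r n => by nlinarith
  have h1 := (hasSum_of_hasProd (hle r) hF).mul_monomial (properWeight_sum (hle r))
    (properWeight_sum (hle s)) (hasSum_of_hasProd (hle s) hG)
  have h2 := (hasSum_thetaSeries u ha (by omega : r ≤ a)).mul_monomial
    (thetaExp_proper ha (by omega)) (Maya.properWeight_neutral.of_le fun x => by nlinarith)
    ((hasSum_neutralSeries R).expand_monomial a ha.ne')
  rw [← Maya.equivNeutral.hasSum_iff] at h1
  refine h2.unique ?_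
  convert h1 using 2 with p
  have hw := Maya.weight_equivNeutral p
  have hc := Maya.charge_equivNeutral p
  have ht := thetaExp_cast ha (by omega : r ≤ a) p.1
  simp only [Function.comp]
  generalize Maya.equivNeutral p = x at hw hc
  generalize Maya.weight p.2.1 = w at hw
  congr 1
  · congr 1
    zify
    rw [ht]
    simp only [Maya.weight, Maya.charge] at hw hc
    push_cast at hw
    simp only [sum_add_distrib, ← mul_sum, sum_const, nsmul_eq_mul, mul_one] at hw ⊢
    rw [← hc] at hw ⊢
    have hs : (s : ℤ) = a - r := by omega
    rw [hs]
    linear_combination (-(a : ℤ)) * hw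
  · rw [← hc, Maya.charge, zpow_sub]
    simp

end Theta

/-! ### The Jacobi triple product and Gauss's product formulas -/

section Products

variable {R : Type*} [CommRing R]

lemma expand_injective (p : ℕ) (hp : p ≠ 0) : Function.Injective (expand (R := R) p hp) :=
  fun F G h => by
  ext n
  rw [← coeff_expand_mul p hp F n, ← coeff_expand_mul p hp G n, h]

variable (R) in
lemma isUnit_pentagonalSeries : IsUnit (pentagonalSeries R) := by
  rw [isUnit_iff_constantCoeff, ← coeff_zero_eq_constantCoeff_apply]
  have := coeff_pentagonalSeries_pentagonal R 0
  rw [show pentagonal 0 = 0 by simp [pentagonal_def]] at this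
  simp [this]

lemma map_pentagonalSeries {S : Type*} [CommRing S] (f : R →+* S) :
    PowerSeries.map f (pentagonalSeries R) = pentagonalSeries S := by
  ext n
  rw [coeff_map]
  by_cases h : n ∈ Set.range pentagonal
  · obtain ⟨k, rfl⟩ := h
    simp
  · rw [coeff_pentagonalSeries_eq_zero R h, coeff_pentagonalSeries_eq_zero S h, map_zero]

lemma one_add_monomial_neg_one (n : ℕ) : (1 : R⟦X⟧) + monomial n (-1) = 1 - X ^ n := by
  rw [X_pow_eq, map_neg, sub_eq_add_neg]

variable [TopologicalSpace R]

lemma hasProd_pentagonalSeries :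
    HasProd (fun n => 1 + monomial (n + 1) (-1 : R)) (pentagonalSeries R) := by
  simpa only [one_add_monomial_neg_one] using WithPiTopology.hasProd_one_sub_X_pow R

lemma hasProd_expand_pentagonalSeries (p : ℕ) (hp : p ≠ 0) :
    HasProd (fun n => 1 + monomial (p * n + p) (-1 : R)) (expand p hp (pentagonalSeries R)) := by
  have h := (hasProd_pentagonalSeries (R := R)).map (expand p hp) (continuous_expand p hp)
  simpa [Function.comp_def, mul_add] using h

lemma exists_hasProd_progression {a : ℕ} (ha : 0 < a) (r : ℕ) (u : R) :
    ∃ G : R⟦X⟧, HasProd (fun n => 1 + monomial (a * n + r) u) G :=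
  (exists_hasProd_hasSum (fun n => by nlinarith) u).imp fun _ h => h.1

variable [DiscreteTopology R]

/-- Euler's product splits over the residue classes modulo `a`. -/
lemma pentagonalSeries_eq_prod (a : ℕ) [NeZero a] {g : Fin a → R⟦X⟧}
    (hg : ∀ r : Fin a, HasProd (fun n => 1 + monomial (a * n + (r + 1)) (-1 : R)) (g r)) :
    pentagonalSeries R = ∏ r, g r := by
  have h := ((Equiv.prodComm _ _).trans (Nat.divModEquiv a).symm).hasProd_iff.2
    (hasProd_pentagonalSeries (R := R))
  refine (h.prod_fiberwise fun r => ?_).unique (hasProd_fintype g)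
  convert hg r using 4 with n
  simp [Nat.divModEquiv, mul_comm, add_assoc]

/-- The pentagonal number theorem in terms of `thetaSeries`. -/
lemma thetaSeries_neg_one_three_one :
    thetaSeries (-1 : Rˣ) 3 1 = pentagonalSeries R := by
  refine (hasSum_thetaSeries (-1 : Rˣ) (by norm_num) (by norm_num)).unique ?_
  convert WithPiTopology.hasSum_pentagonalSeries R using 2 with k
  have h1 : thetaExp 3 1 k = pentagonal k := by
    zify
    rw [thetaExp_cast (by norm_num) (by norm_num), natCast_pentagonal]
    have h := two_mul_choose_two k
    have : k * (3 * k - 1) = 2 * (3 * (k * (k - 1) / 2) + k) := by linear_combination (-3) * h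
    rw [this]
    push_cast
    omega
  have h2 : (((-1 : Rˣ) ^ k : Rˣ) : R) = ((Int.negOnePow k : ℤ) : R) := by
    rcases Int.even_or_odd k with hk | hk
    · simp [hk.neg_one_zpow, Int.negOnePow_even k hk]
    · simp [hk.neg_one_zpow, Int.negOnePow_odd k hk]
  rw [h1, h2, monomial_eq_C_mul_X_pow, map_intCast]

/-- The neutral Maya diagrams are counted by the reciprocal of Euler's product. This follows by
comparing the triple product at `X ^ 3` and `-X` with the pentagonal number theorem. -/
lemma neutralSeries_mul_pentagonalSeries : neutralSeries R * pentagonalSeries R = 1 := by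
  obtain ⟨F, hF⟩ := exists_hasProd_progression (R := R) (a := 3) (by norm_num) 1 (-1)
  obtain ⟨G, hG⟩ := exists_hasProd_progression (R := R) (a := 3) (by norm_num) 2 (-1)
  have h1 := thetaSeries_mul_neutralSeries (-1 : Rˣ) (a := 3) (r := 1) (s := 2) (by norm_num)
    (by norm_num) (by simpa using hF) (by simpa using hG)
  have h2 := pentagonalSeries_eq_prod 3
    (g := ![F, G, expand 3 (by norm_num) (pentagonalSeries R)]) (fun r => by
      fin_cases r
      · simpa using hF
      · simpa using hG
      · simpa using hasProd_expand_pentagonalSeries (R := R) 3 (by norm_num))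
  rw [thetaSeries_neg_one_three_one] at h1
  refine expand_injective 3 (by norm_num) ((isUnit_pentagonalSeries R).mul_left_cancel ?_)
  simp only [Fin.prod_univ_three, Matrix.cons_val] at h2
  rw [map_mul, map_one, mul_one, ← mul_assoc, h1, ← h2]

/-- **Jacobi triple product identity**, in base `X ^ a` and at the point `u * X ^ r`. -/
theorem thetaSeries_eq (u : Rˣ) {a r s : ℕ} (ha : 0 < a) (hrs : r + s = a)
    {F G : R⟦X⟧} (hF : HasProd (fun n => 1 + monomial (a * n + r) (u : R)) F)
    (hG : HasProd (fun n => 1 + monomial (a * n + s) ((u⁻¹ : Rˣ) : R)) G) :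
    thetaSeries u a r = F * G * expand a ha.ne' (pentagonalSeries R) := by
  rw [← thetaSeries_mul_neutralSeries u ha hrs hF hG, mul_assoc, ← map_mul,
    neutralSeries_mul_pentagonalSeries, map_one, mul_one]

/-- Gauss's identity `φ(-q) (q²; q²) = (q; q)²`. -/
lemma thetaSeries_neg_one_two_one_mul :
    thetaSeries (-1 : Rˣ) 2 1 * expand 2 two_ne_zero (pentagonalSeries R) =
      pentagonalSeries R ^ 2 := by
  obtain ⟨F, hF⟩ := exists_hasProd_progression (R := R) (a := 2) (by norm_num) 1 (-1)
  have h1 := thetaSeries_eq (-1 : Rˣ) (a := 2) (r := 1) (s := 1) (by norm_num)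
    (by norm_num) (by simpa using hF) (by simpa using hF)
  have h2 := pentagonalSeries_eq_prod 2
    (g := ![F, expand 2 (by norm_num) (pentagonalSeries R)]) (fun r => by
      fin_cases r
      · simpa using hF
      · simpa using hasProd_expand_pentagonalSeries (R := R) 2 (by norm_num))
  simp only [Fin.prod_univ_two, Matrix.cons_val_zero, Matrix.cons_val_one] at h2
  rw [h1]
  nth_rewrite 3 [h2]
  ring

/-- Gauss's identity `2 ψ(q) (q; q) = 2 (q²; q²)²`. -/
lemma thetaSeries_one_one_one_mul :
    thetaSeries (1 : Rˣ) 1 1 * pentagonalSeries R =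
      2 * expand 2 two_ne_zero (pentagonalSeries R) ^ 2 := by
  obtain ⟨F, hF⟩ := exists_hasProd_progression (R := R) (a := 1) (by norm_num) 1 1
  -- The second product has the additional factor `1 + 1` at `n = 0`.
  have hG : HasProd (fun n => 1 + monomial (1 * n + 0) (1 : R)) (2 * F) := by
    convert HasProd.zero_mul (f := fun n => 1 + monomial (1 * n + 0) (1 : R)) ?_ using 2
    · simp [one_add_one_eq_two]
    · simpa using hF
  have h1 := thetaSeries_eq (1 : Rˣ) (a := 1) (r := 1) (s := 0) (by norm_num)
    (by norm_num) (by simpa using hF) (by simpa using hG)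
  have h2 : expand 2 two_ne_zero (pentagonalSeries R) = F * pentagonalSeries R := by
    refine (hasProd_expand_pentagonalSeries 2 two_ne_zero).unique ?_
    convert hF.mul (hasProd_pentagonalSeries (R := R)) using 2 with n
    rw [one_add_monomial_neg_one, one_add_monomial_neg_one, ← X_pow_eq]
    ring
  rw [h1, h2, expand_one_apply]
  ring

end Products

/-! ### Jacobi's identity for the cube of Euler's product -/

section Cube

open TrivSqZeroExt DualNumber

variable {R : Type*} [CommRing R]

/-- The unit `-(1 - ε)` of the dual numbers, an infinitesimal deformation of `-1`. -/
def dualUnit (R : Type*) [CommRing R] : (DualNumber R)ˣ where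
  val := -(1 - ε)
  inv := -(1 + ε)
  val_inv := by linear_combination -(eps_mul_eps (R := R))
  inv_val := by linear_combination -(eps_mul_eps (R := R))

lemma dualUnit_pow (n : ℕ) :
    ((dualUnit R ^ (n : ℤ) : (DualNumber R)ˣ) : DualNumber R) =
      (-1) ^ n * (1 - (n : DualNumber R) * ε) := by
  rw [zpow_natCast, Units.val_pow_eq_pow_val]
  induction n with
  | zero => simp
  | succ n ih =>
    rw [pow_succ, ih]
    simp only [dualUnit]
    push_cast
    linear_combination (-1) ^ n * (-n) * (eps_mul_eps (R := R))

lemma dualUnit_pow_neg (n : ℕ) :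
    ((dualUnit R ^ (-(n : ℤ)) : (DualNumber R)ˣ) : DualNumber R) =
      (-1) ^ n * (1 + (n : DualNumber R) * ε) := by
  rw [zpow_neg, zpow_natCast, ← inv_pow, Units.val_pow_eq_pow_val]
  induction n with
  | zero => simp
  | succ n ih =>
    rw [pow_succ, ih]
    simp only [dualUnit, Units.inv_mk]
    push_cast
    linear_combination (-1) ^ n * (-n) * (eps_mul_eps (R := R))

variable [TopologicalSpace R] [DiscreteTopology R]

instance DualNumber.instDiscreteTopology : DiscreteTopology (DualNumber R) :=
  inferInstanceAs (DiscreteTopology (R × R))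

lemma thetaSeries_dualUnit :
    thetaSeries (dualUnit R) 1 1 = C (-ε) * pentagonalSeries (DualNumber R) ^ 3 := by
  obtain ⟨F, hF⟩ := exists_hasProd_progression (a := 1) (by norm_num) 1
    (dualUnit R : DualNumber R)
  obtain ⟨G, hG⟩ := exists_hasProd_progression (a := 1) (by norm_num) 1
    ((dualUnit R)⁻¹ : (DualNumber R)ˣ).val
  -- The factor at `n = 0` of the second product is `1 - (1 + ε) = -ε`.
  have hG' : HasProd (fun n => 1 + monomial (1 * n + 0) ((dualUnit R)⁻¹ : (DualNumber R)ˣ).val)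
      (C (-ε) * G) := by
    convert HasProd.zero_mul
      (f := fun n => 1 + monomial (1 * n + 0) ((dualUnit R)⁻¹ : (DualNumber R)ˣ).val) ?_ using 2
    · simp [dualUnit]
    · simpa using hG
  have h1 := thetaSeries_eq (dualUnit R) (a := 1) (r := 1) (s := 0) (by norm_num)
    (by norm_num) hF hG'
  have h2 : F * G = pentagonalSeries (DualNumber R) * pentagonalSeries (DualNumber R) := by
    refine (hF.mul hG).unique ?_
    convert (hasProd_pentagonalSeries (R := DualNumber R)).mul hasProd_pentagonalSeries using 2
      with n
    have h3 : C (ε : DualNumber R) * C ε = 0 := by rw [← map_mul, eps_mul_eps, map_zero]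
    simp only [one_mul, monomial_eq_C_mul_X_pow, dualUnit, Units.inv_mk, map_neg, map_one, map_add,
      map_sub]
    linear_combination (-X ^ (n + 1) * X ^ (n + 1)) * h3
  rw [h1, expand_one_apply]
  linear_combination C (-ε) * pentagonalSeries (DualNumber R) * h2

/-- **Jacobi's identity** for the cube of Euler's product, obtained as the first-order term of the
triple product identity at `-1`. -/
theorem hasSum_pentagonalSeries_cube :
    HasSum (fun n : ℕ => monomial (n * (n + 1) / 2) ((-1 : R) ^ n * (2 * n + 1)))
      (pentagonalSeries R ^ 3) := by
  have h := (hasSum_thetaSeries (dualUnit R) (a := 1) (r := 1) (by norm_num)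
    le_rfl).nat_add_neg_add_one
  -- The indices `n` and `-(n + 1)` give the same exponent.
  have e : ∀ n : ℕ, thetaExp 1 1 n = n * (n + 1) / 2 ∧
      thetaExp 1 1 (-((n : ℤ) + 1)) = n * (n + 1) / 2 :=
    fun n => by
    have h1 := two_mul_choose_two (n : ℤ)
    have h2 := two_mul_choose_two (-((n : ℤ) + 1))
    have h3 := thetaExp_cast (a := 1) (r := 1) (by norm_num) le_rfl (n : ℤ)
    have h4 := thetaExp_cast (a := 1) (r := 1) (by norm_num) le_rfl (-((n : ℤ) + 1))
    push_cast at h3 h4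
    have h5 : 2 * (thetaExp 1 1 n : ℤ) = n * (n + 1) := by linear_combination 2 * h3 + h1
    have h6 : 2 * (thetaExp 1 1 (-((n : ℤ) + 1)) : ℤ) = n * (n + 1) := by
      linear_combination 2 * h4 + h2
    norm_cast at h5
    have h7 : 2 * thetaExp 1 1 (-((n : ℤ) + 1)) = n * (n + 1) := by exact_mod_cast h6
    omega
  rw [thetaSeries_dualUnit] at h
  rw [WithPiTopology.hasSum_iff_hasSum_coeff] at h ⊢
  intro d
  have h' := (hasSum_snd R (h d)).neg
  rw [← map_pentagonalSeries (algebraMap R (DualNumber R)), ← map_pow, coeff_C_mul,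
    coeff_map] at h'
  have hε : ∀ x : R, snd (algebraMap R (DualNumber R) x * ε) = x := fun x => by
    simp [algebraMap_eq_inl]
  convert h' using 1
  · rfl
  · funext n
    have := dualUnit_pow_neg (R := R) (n + 1)
    push_cast at this
    rw [(e n).1, (e n).2, ← map_add, coeff_monomial, coeff_monomial, dualUnit_pow, this]
    split_ifs
    · rw [← neg_eq_iff_eq_neg, ← hε (-((-1) ^ n * (2 * n + 1)))]
      congr 1
      simp only [map_neg, map_mul, map_pow, map_add, map_one, map_natCast, map_ofNat]
      ring
    · simp
  · rw [neg_mul, mul_comm, snd_neg, hε, neg_neg]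

end Cube

/-! ### The generating function of colored Frobenius partitions -/

section Frobenius

variable {k : ℕ}

/-- A finite set of colored integers, split into its color classes. -/
noncomputable def colorClasses (k : ℕ) : Finset (ColoredNat k) ≃ (Fin k → Finset ℕ) where
  toFun A i := (A.filter fun x => (ofLex x).2 = i).image ColoredNat.size
  invFun f := univ.biUnion fun i => (f i).image fun n => toLex (n, i)
  left_inv A := by
    ext x
    obtain ⟨⟨n, i⟩, rfl⟩ := toLex.surjective x
    simp [ColoredNat.size, toLex.surjective.exists]
  right_inv f := by
    ext i n
    simp [ColoredNat.size, toLex.surjective.exists]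

lemma sum_colorClasses {M : Type*} [AddCommMonoid M] (A : Finset (ColoredNat k)) (g : ℕ → M) :
    ∑ i, ∑ n ∈ colorClasses k A i, g n = ∑ x ∈ A, g x.size := by
  rw [← sum_fiberwise A fun x => (ofLex x).2]
  refine sum_congr rfl fun i _ => sum_image fun x hx y hy h => ?_
  simp only [coe_filter, Set.mem_ofPred_eq] at hx hy
  exact ofLex.injective (Prod.ext h (hx.2.trans hy.2.symm))

lemma sum_colorClasses_toFinset {M : Type*} [AddCommMonoid M] {l : List (ColoredNat k)}
    (hl : l.Pairwise (· > ·)) (g : ℕ → M) :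
    ∑ i, ∑ n ∈ colorClasses k l.toFinset i, g n = (l.map fun x => g x.size).sum := by
  rw [sum_colorClasses, List.sum_toFinset _ (hl.imp fun h => ne_of_gt h)]

lemma pairwise_sort_ge (A : Finset (ColoredNat k)) : (A.sort (· ≥ ·)).Pairwise (· > ·) :=
  (sortedGT_sort A).pairwise

lemma sum_map_sort {M : Type*} [AddCommMonoid M] (f : Fin k → Finset ℕ) (g : ℕ → M) :
    ((((colorClasses k).symm f).sort (· ≥ ·)).map fun x => g x.size).sum =
      ∑ i, ∑ n ∈ f i, g n := by
  rw [← sum_colorClasses_toFinset (pairwise_sort_ge _), sort_toFinset, Equiv.apply_symm_apply]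

/-- Families of `k` Maya diagrams of total charge zero. -/
abbrev NeutralFamily (k : ℕ) : Type := {y : Fin k → Maya // ∑ i, (y i).charge = 0}

lemma length_eq_sum_map {α : Type*} (l : List α) : l.length = (l.map fun _ => 1).sum := by simp

/-- A `k`-colored generalized Frobenius partition is a family of `k` Maya diagrams of total charge
zero: the lower row records the particles and the upper row the holes. -/
noncomputable def coloredFrobeniusEquiv (k n : ℕ) :
    ColoredFrobeniusPartition k n ≃ {y : NeutralFamily k // ∑ i, (y.1 i).weight = n} where
  toFun P := ⟨⟨fun i => (colorClasses k P.bot.toFinset i, colorClasses k P.top.toFinset i), by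
      simp only [Maya.charge, sum_sub_distrib, card_eq_sum_ones]
      push_cast
      rw [sum_colorClasses_toFinset P.bot_decreasing, sum_colorClasses_toFinset P.top_decreasing]
      simp [P.length_eq]⟩, by
    simp only [Maya.weight, sum_add_distrib]
    rw [sum_colorClasses_toFinset P.bot_decreasing (fun n => n),
      sum_colorClasses_toFinset P.top_decreasing (fun n => n),
      sum_colorClasses_toFinset P.top_decreasing (fun _ => 1), ← length_eq_sum_map]
    have : P.top.length + (P.top.map fun x => x.size).sum + (P.bot.map fun x => x.size).sum = n :=
      P.weight_eq
    omega⟩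
  invFun y :=
    { top := ((colorClasses k).symm fun i => (y.1.1 i).2).sort (· ≥ ·)
      bot := ((colorClasses k).symm fun i => (y.1.1 i).1).sort (· ≥ ·)
      length_eq := by
        have h := y.1.2
        simp only [Maya.charge, sum_sub_distrib, card_eq_sum_ones] at h
        rw [length_eq_sum_map, length_eq_sum_map, sum_map_sort _ fun _ => 1,
          sum_map_sort _ fun _ => 1]
        zify
        push_cast at h
        linarith
      top_decreasing := pairwise_sort_ge _
      bot_decreasing := pairwise_sort_ge _
      weight_eq := by
        have h := y.2
        simp only [Maya.weight, sum_add_distrib] at h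
        rw [length_eq_sum_map, sum_map_sort _ fun _ => 1]
        change _ + (List.map (fun x : ColoredNat k => x.size) _).sum +
          (List.map (fun x : ColoredNat k => x.size) _).sum = n
        have h1 := sum_map_sort (fun i => (y.1.1 i).1) fun n => n
        have h2 := sum_map_sort (fun i => (y.1.1 i).2) fun n => n
        omega }
  left_inv P := by
    ext1
    · simpa using (List.toFinset_sort (· ≥ ·) (P.top_decreasing.imp fun h => ne_of_gt h)).2
        (P.top_decreasing.imp fun h => le_of_lt h)
    · simpa using (List.toFinset_sort (· ≥ ·) (P.bot_decreasing.imp fun h => ne_of_gt h)).2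
        (P.bot_decreasing.imp fun h => le_of_lt h)
  right_inv y := by
    refine Subtype.ext (Subtype.ext (funext fun i => ?_))
    simp only [sort_toFinset, Equiv.apply_symm_apply]

/-- Integer vectors of coordinate sum zero: the root lattice of type `A`. -/
abbrev RootLattice (k : ℕ) : Type := {m : Fin k → ℤ // ∑ i, m i = 0}

/-- Splitting off the charges of a family of Maya diagrams. -/
noncomputable def neutralFamilyEquiv (k : ℕ) :
    RootLattice k × (Fin k → Maya.Neutral) ≃ NeutralFamily k where
  toFun p := ⟨fun i => Maya.equivNeutral (p.1.1 i, p.2 i), by simpa using p.1.2⟩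
  invFun y := (⟨fun i => (Maya.equivNeutral.symm (y.1 i)).1, y.2⟩,
    fun i => (Maya.equivNeutral.symm (y.1 i)).2)
  left_inv p := by simp
  right_inv y := by simp

variable (R : Type*) [CommRing R] [TopologicalSpace R]

/-- The theta series of the root lattice of type `A`. -/
noncomputable def rootTheta (k : ℕ) : R⟦X⟧ :=
  ∑' m : RootLattice k, monomial (∑ i, thetaExp 1 0 (m.1 i)) 1

lemma rootLattice_proper (k : ℕ) :
    ProperWeight fun m : RootLattice k => ∑ i, thetaExp 1 0 (m.1 i) :=
  ((thetaExp_proper one_pos (Nat.zero_le 1)).pi k).comp_injective Subtype.val_injective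

lemma hasSum_rootTheta (k : ℕ) :
    HasSum (fun m : RootLattice k => monomial (∑ i, thetaExp 1 0 (m.1 i)) (1 : R))
      (rootTheta R k) :=
  ((rootLattice_proper k).summable _).hasSum

lemma neutralFamily_proper (k : ℕ) :
    ProperWeight fun y : NeutralFamily k => ∑ i, (y.1 i).weight :=
  (Maya.properWeight.pi k).comp_injective Subtype.val_injective

lemma hasSum_cφ (k : ℕ) :
    HasSum (fun y : NeutralFamily k => monomial (∑ i, (y.1 i).weight) (1 : R))
      (mk fun n => (cφ k n : R)) := by
  convert (neutralFamily_proper k).hasSum_card (R := R) using 4 with n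
  exact Nat.card_congr (coloredFrobeniusEquiv k n)

/-- Andrews' generating function: the colored Frobenius partitions are enumerated by the theta
series of the root lattice divided by a power of Euler's product. -/
theorem cφ_mul_pentagonalSeries_pow [DiscreteTopology R] (k : ℕ) :
    (mk fun n => (cφ k n : R)) * pentagonalSeries R ^ k = rootTheta R k := by
  have h1 := (hasSum_rootTheta R k).mul_monomial (rootLattice_proper k)
    (Maya.properWeight_neutral.pi k)
    ((hasSum_neutralSeries R).pow_monomial Maya.properWeight_neutral k)
  have h2 := (neutralFamilyEquiv k).hasSum_iff.2 (hasSum_cφ R k)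
  have h3 : (mk fun n => (cφ k n : R)) = rootTheta R k * neutralSeries R ^ k := by
    refine h2.unique ?_
    convert h1 using 2 with p
    simp only [Function.comp, neutralFamilyEquiv, Equiv.coe_fn_mk, mul_one]
    congr 1
    rw [← sum_add_distrib]
    congr 1
    refine sum_congr rfl fun i _ => ?_
    have h := Maya.weight_equivNeutral (p.1.1 i, p.2 i)
    zify
    rw [h, thetaExp_cast one_pos (Nat.zero_le 1)]
    push_cast
    ring
  rw [h3, mul_assoc, ← mul_pow, neutralSeries_mul_pentagonalSeries, one_pow, mul_one]

end Frobenius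

/-! ### Theta identities from changes of lattice basis -/

section Lattices

lemma thetaExp_two_one (m : ℤ) : (thetaExp 2 1 m : ℤ) = m ^ 2 := by
  rw [thetaExp_cast (by norm_num) (by norm_num)]
  push_cast
  linear_combination two_mul_choose_two m

lemma two_mul_thetaExp_one_one (m : ℤ) : 2 * (thetaExp 1 1 m : ℤ) = m * (m + 1) := by
  rw [thetaExp_cast (by norm_num) (by norm_num)]
  push_cast
  linear_combination two_mul_choose_two m

lemma two_mul_thetaExp_one_zero (m : ℤ) : 2 * (thetaExp 1 0 m : ℤ) = m * (m - 1) := by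
  rw [thetaExp_cast (by norm_num) (by norm_num)]
  push_cast
  linear_combination two_mul_choose_two m

/-- Pairs of integers, split according to the parity of their sum and written in terms of half the
sum and half the difference. -/
noncomputable def parityEquiv : (ℤ × ℤ) ⊕ (ℤ × ℤ) ≃ ℤ × ℤ :=
  Equiv.ofBijective
    (Sum.elim (fun p => (p.1 + p.2, p.1 - p.2)) fun p => (p.1 + p.2 + 1, p.1 - p.2)) <| by
    constructor
    · rintro (⟨a, b⟩ | ⟨a, b⟩) (⟨c, d⟩ | ⟨c, d⟩) h <;>
        simp only [Sum.elim_inl, Sum.elim_inr, Prod.mk.injEq] at h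
      · obtain ⟨rfl, rfl⟩ : a = c ∧ b = d := by omega
        rfl
      · omega
      · omega
      · obtain ⟨rfl, rfl⟩ : a = c ∧ b = d := by omega
        rfl
    · rintro ⟨m, n⟩
      rcases Int.even_or_odd' (m + n) with ⟨c, hc | hc⟩
      · exact ⟨Sum.inl (c, m - c), by simp only [Sum.elim_inl, Prod.mk.injEq]; omega⟩
      · exact ⟨Sum.inr (c, m - c - 1), by simp only [Sum.elim_inr, Prod.mk.injEq]; omega⟩

lemma parityEquiv_inl (s d : ℤ) : parityEquiv (.inl (s, d)) = (s + d, s - d) := rfl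

lemma parityEquiv_inr (s d : ℤ) : parityEquiv (.inr (s, d)) = (s + d + 1, s - d) := rfl

/-- The root lattice of type `A₃`, split according to the parity of the sum of the first two
coordinates. -/
noncomputable def rootLatticeEquiv : (ℤ × ℤ × ℤ) ⊕ (ℤ × ℤ × ℤ) ≃ RootLattice 4 :=
  Equiv.ofBijective
    (Sum.elim
      (fun p => ⟨![p.1 + p.2.1, p.1 - p.2.1, -p.1 + p.2.2, -p.1 - p.2.2], by
        simp [Fin.sum_univ_four]⟩)
      fun p => ⟨![p.1 + p.2.1 + 1, p.1 - p.2.1, -p.1 + p.2.2, -p.1 - p.2.2 - 1], by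
        simp [Fin.sum_univ_four]; ring⟩) <| by
    constructor
    · rintro (⟨a, b, c⟩ | ⟨a, b, c⟩) (⟨a', b', c'⟩ | ⟨a', b', c'⟩) h <;>
        simp only [Sum.elim_inl, Sum.elim_inr, Subtype.mk.injEq, Matrix.vecCons_inj] at h
      · obtain ⟨rfl, rfl, rfl⟩ : a = a' ∧ b = b' ∧ c = c' := by omega
        rfl
      · omega
      · omega
      · obtain ⟨rfl, rfl, rfl⟩ : a = a' ∧ b = b' ∧ c = c' := by omega
        rfl
    · rintro ⟨m, hm⟩
      rw [Fin.sum_univ_four] at hm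
      rcases Int.even_or_odd' (m 0 + m 1) with ⟨s, hs | hs⟩
      · refine ⟨Sum.inl (s, m 0 - s, m 2 + s), Subtype.ext (funext fun i => ?_)⟩
        fin_cases i <;> simp <;> omega
      · refine ⟨Sum.inr (s, m 0 - s - 1, m 2 + s), Subtype.ext (funext fun i => ?_)⟩
        fin_cases i <;> simp <;> omega

lemma rootLatticeEquiv_inl (s d e : ℤ) :
    (rootLatticeEquiv (.inl (s, d, e))).1 = ![s + d, s - d, -s + e, -s - e] := rfl

lemma rootLatticeEquiv_inr (s d e : ℤ) :
    (rootLatticeEquiv (.inr (s, d, e))).1 = ![s + d + 1, s - d, -s + e, -s - e - 1] := rfl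

variable {R : Type*} [CommRing R] [TopologicalSpace R]

lemma hasSum_one_theta {a r : ℕ} (ha : 0 < a) (hr : r ≤ a) :
    HasSum (fun m : ℤ => monomial (thetaExp a r m) (1 : R)) (thetaSeries 1 a r) := by
  simpa using hasSum_thetaSeries (1 : Rˣ) ha hr

variable [DiscreteTopology R]

/-- Rotating the square lattice by 45 degrees in a product of two theta functions. -/
lemma thetaSeries_two_one_mul (u v : Rˣ) :
    thetaSeries u 2 1 * thetaSeries v 2 1 =
      expand 2 two_ne_zero (thetaSeries (u * v) 2 1) * expand 2 two_ne_zero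
        (thetaSeries (u / v) 2 1) +
      monomial 1 (u : R) * (expand 4 four_ne_zero (thetaSeries (u * v) 1 1) *
        expand 4 four_ne_zero (thetaSeries (u / v) 1 1)) := by
  have p2 := thetaExp_proper (a := 2) (r := 1) (by norm_num) (by norm_num)
  have p1 := thetaExp_proper (a := 1) (r := 1) (by norm_num) (by norm_num)
  have h2 := fun u : Rˣ => hasSum_thetaSeries u (a := 2) (r := 1) (by norm_num) (by norm_num)
  have h1 := fun u : Rˣ => hasSum_thetaSeries u (a := 1) (r := 1) (by norm_num) (by norm_num)
  have p22 : ProperWeight fun m => 2 * thetaExp 2 1 m := p2.of_le fun m => by omega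
  have p14 : ProperWeight fun m => 4 * thetaExp 1 1 m := p1.of_le fun m => by omega
  have h := parityEquiv.hasSum_iff.2 ((h2 u).mul_monomial p2 p2 (h2 v))
  refine h.unique (HasSum.sum ?_ ?_)
  · convert ((h2 (u * v)).expand_monomial 2 two_ne_zero).mul_monomial p22 p22
      ((h2 (u / v)).expand_monomial 2 two_ne_zero) using 2 with p
    obtain ⟨s, d⟩ := p
    simp only [Function.comp, parityEquiv_inl]
    congr 1
    · congr 1
      zify
      simp only [thetaExp_two_one]
      ring
    · norm_cast
      rw [mul_zpow, div_zpow, zpow_add, zpow_sub]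
      simp only [div_eq_mul_inv, mul_assoc, mul_left_comm]
  · convert (((h1 (u * v)).expand_monomial 4 four_ne_zero).mul_monomial p14 p14
      ((h1 (u / v)).expand_monomial 4 four_ne_zero)).monomial_mul_monomial 1 (u : R)
      using 2 with p
    obtain ⟨s, d⟩ := p
    simp only [Function.comp, parityEquiv_inr]
    congr 1
    · congr 1
      zify
      simp only [thetaExp_two_one]
      linear_combination (-2) * two_mul_thetaExp_one_one s - 2 * two_mul_thetaExp_one_one d
    · norm_cast
      rw [mul_zpow, div_zpow, zpow_add, zpow_sub, zpow_add, zpow_one]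
      simp only [div_eq_mul_inv, mul_assoc, mul_comm, mul_left_comm]

/-- The bisection `φ(q)² = φ(q²)² + 4 q ψ(q⁴)²`. -/
lemma thetaSeries_one_sq :
    thetaSeries (1 : Rˣ) 2 1 ^ 2 = expand 2 two_ne_zero (thetaSeries 1 2 1) ^ 2 +
      X * expand 4 four_ne_zero (thetaSeries (1 : Rˣ) 1 1) ^ 2 := by
  have h := thetaSeries_two_one_mul (1 : Rˣ) 1
  simp only [mul_one, div_one, Units.val_one] at h
  rw [sq, h, X_eq]
  ring

/-- The alternating sum over the triangular numbers cancels; this is the zero of the triple product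
at `-1`. -/
lemma thetaSeries_neg_one_one_one : thetaSeries (-1 : Rˣ) 1 1 = 0 := by
  obtain ⟨F, hF⟩ := exists_hasProd_progression (R := R) (a := 1) (by norm_num) 1 (-1)
  have hG : HasProd (fun n => 1 + monomial (1 * n + 0) (-1 : R)) 0 :=
    hasProd_zero_of_exists_eq_zero ⟨0, by simp⟩
  rw [thetaSeries_eq (-1 : Rˣ) (a := 1) (r := 1) (s := 0) (by norm_num)
    (by norm_num) (by simpa using hF) (by simpa using hG)]
  ring

/-- The identity `φ(q) φ(-q) = φ(-q²)²`. -/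
lemma thetaSeries_one_mul_neg_one :
    thetaSeries (1 : Rˣ) 2 1 * thetaSeries (-1) 2 1 =
      expand 2 two_ne_zero (thetaSeries (-1 : Rˣ) 2 1) ^ 2 := by
  have h := thetaSeries_two_one_mul (1 : Rˣ) (-1)
  simp only [one_mul, one_div, inv_neg, inv_one, thetaSeries_neg_one_one_one] at h
  rw [h]
  simp [sq]

/-- The identity `ψ(q)² = φ(q) ψ(q²)` for `2 * ψ(q) = ∑ m : ℤ, X ^ (m * (m + 1) / 2)`. -/
lemma thetaSeries_one_one_sq :
    thetaSeries (1 : Rˣ) 1 1 ^ 2 =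
      2 * (thetaSeries 1 2 1 * expand 2 two_ne_zero (thetaSeries (1 : Rˣ) 1 1)) := by
  have p2 := thetaExp_proper (a := 2) (r := 1) (by norm_num) (by norm_num)
  have p1 := thetaExp_proper (a := 1) (r := 1) (by norm_num) (by norm_num)
  have h2 := hasSum_one_theta (R := R) (a := 2) (r := 1) (by norm_num) (by norm_num)
  have h1 := hasSum_one_theta (R := R) (a := 1) (r := 1) (by norm_num) (by norm_num)
  have p12 : ProperWeight fun m => 2 * thetaExp 1 1 m := p1.of_le fun m => by omega
  have h := parityEquiv.hasSum_iff.2 (h1.mul_monomial p1 p1 h1)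
  rw [sq, two_mul]
  refine h.unique (HasSum.sum ?_ ?_)
  · rw [← (Equiv.prodComm ℤ ℤ).hasSum_iff]
    convert h2.mul_monomial p2 p12 (h1.expand_monomial 2 two_ne_zero) using 2 with p
    obtain ⟨d, s⟩ := p
    simp only [Function.comp, parityEquiv_inl,
      Equiv.prodComm_apply, Prod.swap]
    congr 2
    zify
    linarith [thetaExp_two_one d, two_mul_thetaExp_one_one s, two_mul_thetaExp_one_one (s + d),
      two_mul_thetaExp_one_one (s - d)]
  · rw [← ((Equiv.subRight (1 : ℤ)).prodCongr (Equiv.refl ℤ)).hasSum_iff]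
    convert h2.mul_monomial p2 p12 (h1.expand_monomial 2 two_ne_zero) using 2 with p
    obtain ⟨s, d⟩ := p
    simp only [Function.comp, parityEquiv_inr,
      Equiv.prodCongr_apply, Prod.map, Equiv.subRight_apply, Equiv.refl_apply]
    congr 2
    zify
    linarith [thetaExp_two_one s, two_mul_thetaExp_one_one d,
      two_mul_thetaExp_one_one (s - 1 + d + 1), two_mul_thetaExp_one_one (s - 1 - d)]

/-- The theta series of the root lattice of type `A₃` in terms of one-dimensional ones. -/
lemma rootTheta_four :
    rootTheta R 4 = expand 2 two_ne_zero (thetaSeries 1 2 1) * thetaSeries (1 : Rˣ) 2 1 ^ 2 +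
      X * (expand 4 four_ne_zero (thetaSeries 1 1 1) *
        expand 2 two_ne_zero (thetaSeries (1 : Rˣ) 1 1) ^ 2) := by
  have p2 := thetaExp_proper (a := 2) (r := 1) (by norm_num) (by norm_num)
  have p1 := thetaExp_proper (a := 1) (r := 1) (by norm_num) (by norm_num)
  have h2 := hasSum_one_theta (R := R) (a := 2) (r := 1) (by norm_num) (by norm_num)
  have h1 := hasSum_one_theta (R := R) (a := 1) (r := 1) (by norm_num) (by norm_num)
  have p22 : ProperWeight fun m => 2 * thetaExp 2 1 m := p2.of_le fun m => by omega
  have p12 : ProperWeight fun m => 2 * thetaExp 1 1 m := p1.of_le fun m => by omega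
  have p14 : ProperWeight fun m => 4 * thetaExp 1 1 m := p1.of_le fun m => by omega
  have h := rootLatticeEquiv.hasSum_iff.2 (hasSum_rootTheta R 4)
  rw [sq, sq]
  refine h.unique (HasSum.sum ?_ ?_)
  · convert (h2.expand_monomial 2 two_ne_zero).mul_monomial p22 (p2.prod p2)
      (h2.mul_monomial p2 p2 h2) using 2 with p
    obtain ⟨s, d, e⟩ := p
    simp only [Function.comp, rootLatticeEquiv_inl,
      Fin.sum_univ_four, Matrix.cons_val, mul_one]
    congr 2
    zify
    linarith [thetaExp_two_one s, thetaExp_two_one d, thetaExp_two_one e,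
      two_mul_thetaExp_one_zero (s + d), two_mul_thetaExp_one_zero (s - d),
      two_mul_thetaExp_one_zero (-s + e), two_mul_thetaExp_one_zero (-s - e)]
  · rw [X_eq]
    convert ((h1.expand_monomial 4 four_ne_zero).mul_monomial p14 (p12.prod p12)
      ((h1.expand_monomial 2 two_ne_zero).mul_monomial p12 p12
        (h1.expand_monomial 2 two_ne_zero))).monomial_mul_monomial 1 (1 : R) using 2 with p
    obtain ⟨s, d, e⟩ := p
    simp only [Function.comp, rootLatticeEquiv_inr,
      Fin.sum_univ_four, Matrix.cons_val, mul_one]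
    congr 2
    zify
    linarith [two_mul_thetaExp_one_one s, two_mul_thetaExp_one_one d, two_mul_thetaExp_one_one e,
      two_mul_thetaExp_one_zero (s + d + 1), two_mul_thetaExp_one_zero (s - d),
      two_mul_thetaExp_one_zero (-s + e), two_mul_thetaExp_one_zero (-s - e - 1)]

end Lattices

/-! ### The congruence modulo 5 -/

section Congruence

lemma sectionSeries_expand {R : Type*} [CommRing R] {p : ℕ} (hp : p ≠ 0) (F : R⟦X⟧) :
    sectionSeries p 0 (expand p hp F) = F := by
  ext n
  simp [sectionSeries, coeff_expand_mul]

lemma sectionSeries_X_mul_expand {R : Type*} [CommRing R] {p : ℕ} (hp : 1 < p) (F : R⟦X⟧) :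
    sectionSeries p 0 (X * expand p (by omega) F) = 0 := by
  ext n
  simp [sectionSeries, coeff_X_mul_expand p hp]

/-- The generating function of the numbers of `4`-colored Frobenius partitions of even integers,
obtained by bisecting the quotient of `rootTheta` by the fourth power of Euler's product. -/
theorem sectionSeries_cφ_mul (R : Type*) [CommRing R] [TopologicalSpace R] [DiscreteTopology R] :
    sectionSeries 2 0 (mk fun n => (cφ 4 n : R)) * pentagonalSeries R ^ 10 =
      expand 2 two_ne_zero (pentagonalSeries R) ^ 4 * thetaSeries 1 2 1 ^ 5 +
        48 * (X * (thetaSeries 1 2 1 * expand 4 four_ne_zero (pentagonalSeries R) ^ 8)) := by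
  have hA := cφ_mul_pentagonalSeries_pow R 4
  rw [rootTheta_four] at hA
  set A : R⟦X⟧ := mk fun n => (cφ 4 n : R)
  have h4 : ∀ F : R⟦X⟧, expand 4 four_ne_zero F = expand 2 two_ne_zero (expand 2 two_ne_zero F) :=
    fun F => expand_mul 2 two_ne_zero 2 two_ne_zero F
  have hφ := thetaSeries_one_sq (R := R)
  have hψ := congrArg (expand 2 two_ne_zero) (thetaSeries_one_one_sq (R := R))
  have hφφ := thetaSeries_one_mul_neg_one (R := R)
  have hE := thetaSeries_neg_one_two_one_mul (R := R)
  have hψE := congrArg (expand 2 two_ne_zero) (thetaSeries_one_one_one_mul (R := R))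
  simp only [map_mul, map_pow, map_ofNat] at hψ hψE
  rw [h4] at hA hφ
  rw [h4]
  set E := pentagonalSeries R
  set φ : R⟦X⟧ := thetaSeries 1 2 1
  set ψ : R⟦X⟧ := expand 2 two_ne_zero (thetaSeries (1 : Rˣ) 1 1)
  set φ' : R⟦X⟧ := thetaSeries (-1) 2 1
  -- Multiplying by `φ(q) ^ 2` turns the denominator `E(q) ^ 4 = φ(-q) ^ 2 * E(q²) ^ 2` into the
  -- series `φ(-q²) ^ 4 * E(q²) ^ 2` in `q²`, since `φ(q) * φ(-q) = φ(-q²) ^ 2`.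
  have key : A * expand 2 two_ne_zero (φ' ^ 4 * E ^ 2) =
      expand 2 two_ne_zero (φ ^ 5 + 3 * X * φ * ψ ^ 4) +
        X * expand 2 two_ne_zero (4 * φ ^ 3 * ψ ^ 2) := by
    simp only [map_mul, map_pow, map_add, map_ofNat, expand_X]
    generalize expand 2 two_ne_zero φ = a at *
    generalize expand 2 two_ne_zero ψ = b at *
    generalize expand 2 two_ne_zero φ' = c at *
    generalize expand 2 two_ne_zero E = e at *
    have h1 : A * (c ^ 4 * e ^ 2) = A * E ^ 4 * φ ^ 2 := by
      have : c ^ 4 * e ^ 2 = E ^ 4 * φ ^ 2 := by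
        rw [show c ^ 4 = (c ^ 2) ^ 2 by ring, ← hφφ, show E ^ 4 = (E ^ 2) ^ 2 by ring, ← hE]
        ring
      rw [this]; ring
    rw [h1, hA, hψ, hφ]
    ring
  have h := congrArg (sectionSeries 2 0) key
  rw [sectionSeries_mul_expand two_ne_zero two_pos, sectionSeries_add, sectionSeries_expand,
    sectionSeries_X_mul_expand one_lt_two, add_zero] at h
  generalize expand 2 two_ne_zero E = e at *
  have h8 : E ^ 10 = φ' ^ 4 * E ^ 2 * e ^ 4 := by
    rw [show E ^ 10 = (E ^ 2) ^ 4 * E ^ 2 by ring, ← hE]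
    ring
  have h9 : (ψ * e) ^ 4 = 16 * expand 2 two_ne_zero e ^ 8 := by
    rw [hψE]
    ring
  rw [h8, ← mul_assoc, h]
  linear_combination 3 * X * φ * h9

/-- Over `ZMod 5` the fifth power is the substitution of `X ^ 5` for `X`. -/
lemma pow_five_eq_expand (F : (ZMod 5)⟦X⟧) : F ^ 5 = expand 5 (by norm_num) F := by
  have : Fact (Nat.Prime 5) := ⟨by norm_num⟩
  have h := MvPowerSeries.map_frobenius_expand (p := 5) (by norm_num) (f := F)
  rw [ZMod.frobenius_zmod, MvPowerSeries.map_id] at h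
  exact h.symm

lemma two_mul_triangular (n : ℕ) : 2 * (n * (n + 1) / 2) = n * (n + 1) :=
  Nat.mul_div_cancel' (Nat.even_mul_succ_self n).two_dvd

lemma triangular_proper : ProperWeight fun n : ℕ => n * (n + 1) / 2 := by
  have h : ProperWeight (id : ℕ → ℕ) := fun n => Set.finite_singleton n
  refine h.of_le fun n => ?_
  have := two_mul_triangular n
  rcases n with _ | n
  · simp
  · simp only [id]
    nlinarith

/-- Ramanujan's congruence modulo `5`, in the form that the fourth power of Euler's product has no
terms with exponents congruent to `4`. -/
lemma coeff_pentagonalSeries_fourth {d : ℕ} (hd : d % 5 = 4) :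
    coeff d (pentagonalSeries (ZMod 5) ^ 4) = 0 := by
  have h := (hasSum_thetaSeries (-1 : (ZMod 5)ˣ) (a := 3) (r := 1) (by norm_num)
    (by norm_num)).mul_monomial (thetaExp_proper (by norm_num) (by norm_num)) triangular_proper
    hasSum_pentagonalSeries_cube
  rw [thetaSeries_neg_one_three_one, ← pow_succ'] at h
  refine h.coeff_eq_zero ?_
  rintro ⟨k, j⟩ hw
  simp only at hw ⊢
  have h1 : 2 * (thetaExp 3 1 k : ℤ) + j * (j + 1) = 2 * d := by
    rw [← hw]
    push_cast
    have := two_mul_triangular j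
    zify at this
    linarith
  rw [thetaExp_cast (by norm_num) (by norm_num)] at h1
  have h2 : (3 * (k * (k - 1)) + 2 * k + j * (j + 1) : ℤ) = 2 * d := by
    push_cast at h1
    linear_combination h1 - 3 * two_mul_choose_two k
  have h3 := congrArg (Int.cast : ℤ → ZMod 5) h2
  have h4 : (d : ZMod 5) = 4 := by
    rw [← ZMod.natCast_mod, hd]; rfl
  push_cast at h3
  rw [h4] at h3
  -- The relation reads `(k - 1) ^ 2 = 2 * (2 * j + 1) ^ 2`, and `2` is not a square modulo `5`.
  have h5 : ∀ x y : ZMod 5, 3 * (x * (x - 1)) + 2 * x + y * (y + 1) = 2 * 4 → 2 * y + 1 = 0 := by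
    decide
  rw [h5 _ _ h3, mul_zero, mul_zero]

/-- The series `q * φ(q) * (q⁴; q⁴)³` modulo `5` has no terms with exponents congruent to `3`. -/
lemma coeff_X_mul_theta_mul {d : ℕ} (hd : d % 5 = 3) :
    coeff d (X * (thetaSeries 1 2 1 *
      expand 4 four_ne_zero (pentagonalSeries (ZMod 5) ^ 3))) = 0 := by
  have h := ((hasSum_one_theta (R := ZMod 5) (a := 2) (r := 1) (by norm_num)
    (by norm_num)).mul_monomial (thetaExp_proper (by norm_num) (by norm_num))
    (triangular_proper.of_le fun n => by omega)
    (hasSum_pentagonalSeries_cube.expand_monomial 4 four_ne_zero)).monomial_mul_monomial 1 1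
  rw [← X_eq] at h
  refine h.coeff_eq_zero ?_
  rintro ⟨k, j⟩ hw
  simp only at hw ⊢
  have h2 : (1 + (k ^ 2 + 2 * (j * (j + 1))) : ℤ) = d := by
    rw [← hw]
    push_cast
    rw [thetaExp_two_one]
    have := two_mul_triangular j
    zify at this
    linarith
  have h3 := congrArg (Int.cast : ℤ → ZMod 5) h2
  have h4 : (d : ZMod 5) = 3 := by
    rw [← ZMod.natCast_mod, hd]; rfl
  push_cast at h3
  rw [h4] at h3
  -- The relation reads `(2 * j + 1) ^ 2 = -2 * k ^ 2`, and `-2` is not a square modulo `5`.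
  have h5 : ∀ x y : ZMod 5, 1 + (x ^ 2 + 2 * (y * (y + 1))) = 3 → 2 * y + 1 = 0 := by
    decide
  rw [h5 _ _ h3, mul_zero, mul_zero, mul_zero]

theorem natCast_cφ_four (n : ℕ) : (cφ 4 (10 * n + 6) : ZMod 5) = 0 := by
  have hB := sectionSeries_cφ_mul (ZMod 5)
  set B := sectionSeries 2 0 (mk fun n => (cφ 4 n : ZMod 5)) with hBdef
  set E := pentagonalSeries (ZMod 5) with hE
  set φ : (ZMod 5)⟦X⟧ := thetaSeries 1 2 1 with hφ
  have h5 : (5 : ℕ) ≠ 0 := by norm_num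
  -- Reducing exponents modulo `5` by means of the Frobenius `F ^ 5 = expand 5 F`.
  have key : B * expand 5 h5 (E ^ 2) = expand 2 two_ne_zero (E ^ 4) * expand 5 h5 φ +
      48 * (X * (φ * expand 4 four_ne_zero (E ^ 3))) *
        expand 5 h5 (expand 4 four_ne_zero E) := by
    simp only [← pow_five_eq_expand, map_pow]
    linear_combination hB
  have h := congrArg (sectionSeries 5 3) key
  rw [sectionSeries_add, sectionSeries_mul_expand h5 (by norm_num),
    sectionSeries_mul_expand h5 (by norm_num), sectionSeries_mul_expand h5 (by norm_num)] at h
  have z1 : sectionSeries 5 3 (expand 2 two_ne_zero (E ^ 4)) = 0 := by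
    ext m
    simp only [sectionSeries, coeff_mk, coeff_expand, map_zero]
    split_ifs with hm
    · exact coeff_pentagonalSeries_fourth (by omega)
    · rfl
  have z2 : sectionSeries 5 3 (48 * (X * (φ * expand 4 four_ne_zero (E ^ 3)))) = 0 := by
    ext m
    rw [sectionSeries, coeff_mk, show (48 : (ZMod 5)⟦X⟧) = C 48 from (map_ofNat C 48).symm,
      coeff_C_mul, coeff_X_mul_theta_mul (by omega), mul_zero, map_zero]
  rw [z1, z2, zero_mul, zero_mul, add_zero] at h
  have h0 := ((isUnit_pentagonalSeries (ZMod 5)).pow 2).mul_left_eq_zero.1 h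
  have h1 := congrArg (coeff n) h0
  simp only [hBdef, sectionSeries, coeff_mk, map_zero] at h1
  rw [← h1]
  congr 2
  ring

end Congruence

end ColoredFrobenius

theorem theorem1 (n : ℕ) : cφ 4 (10 * n + 6) ≡ 0 [MOD 5] :=
  (ZMod.natCast_eq_natCast_iff _ _ 5).1 ((natCast_cφ_four n).trans Nat.cast_zero.symm)
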